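/- Let $a\in(0,2]$ be a fixed real number and, for integers $n\ge 2$, let $T_n(x)=x^n-ax-1$. Let $P_n$ be the product of those complex roots of $T_n$, counted with multiplicity, whose modulus is greater than $1$. Then $P_n$ is equal to the Mahler measure $M(T_n)=\exp\left(\int_0^1\ln|T_n(e^{2\pi i\theta})|\,d\theta\right)=\prod_{i=1}^{n}\max(|\alpha_i|,1)$, where $\alpha_1,\dots,\alpha_n$ are the complex roots of $T_n$ with multiplicity, and \[ \lim_{n\to\infty}P_n=\exp\left(\frac{1}{2\pi}\int_0^{\arccos(-a/2)}\ln(1+a^2+2a\cos t)\,dt\right). \] -/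

import Mathlib

open Polynomial in
/-- The trinomial `x ^ n - a x - 1`, as a polynomial over `ℂ`. -/
noncomputable def unitTrinomial (a : ℝ) (n : ℕ) : ℂ[X] :=
  X ^ n - C (a : ℂ) * X - 1

/-- The product of the complex roots of `p`, counted with multiplicity, whose modulus is
greater than `1`. -/
noncomputable def prodRootsOutside (p : Polynomial ℂ) : ℂ :=
  (p.roots.filter fun z => 1 < ‖z‖).prod

/-!
For `0 ≤ a ≤ 2` and real `x < -1` we have `|a * x + 1| < x ^ 2 ≤ |x ^ n|`, so every real root of
the trinomial outside the closed unit disc is positive. The other roots outside the disc come in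
conjugate pairs, hence their product is nonnegative and equals the product of their moduli, which
is the Mahler measure.

For the limit, let `q` be a polynomial and `w` a point of the unit circle. Writing
`log |w ^ n - q(w)| = log⁺ |q(w)| + log |1 - w ^ n * g(w)|`, with `g` equal to `1 / q` where
`|q| > 1` and to the complex conjugate of `q` elsewhere, we have `|g| < 1` almost everywhere.
Every term of the power series of `log (1 - w ^ n * g(w))` contains a positive power of `w ^ n`, so
by the Riemann–Lebesgue lemma its integral tends to `0` as `n → ∞`. The series is dominated by
`-log (1 - |g|)`, which is integrable because `1 - |q| ^ 2` is a real-analytic function of the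
angle. So the logarithmic Mahler measure of `X ^ n - q` tends to the circle average of `log⁺ |q|`.
For `q = a * X + 1` we have `|q(w)| ^ 2 = 1 + a ^ 2 + 2 * a * cos t` at `w = exp (i * t)`, which
for `0 ≤ t ≤ π` exceeds `1` exactly up to `t = arccos (-a / 2)`.
-/

open Filter MeasureTheory Polynomial Topology
open scoped ComplexConjugate

section RootProducts

open scoped ComplexOrder

theorem multiset_prod_nonneg_of_map_conj_eq {s : Multiset ℂ} (hconj : s.map conj = s)
    (hreal : ∀ x : ℝ, (x : ℂ) ∈ s → 0 ≤ x) : 0 ≤ s.prod := by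
  have hlower : s.filter (·.im < 0) = (s.filter (0 < ·.im)).map conj := by
    conv_lhs => rw [← hconj]
    simp [Multiset.filter_map]
  have hsplit : s = s.filter (·.im = 0) + (s.filter (0 < ·.im) + s.filter (·.im < 0)) := by
    ext z
    simp only [Multiset.count_add, Multiset.count_filter]
    grind
  have hreal_prod : 0 ≤ (s.filter (·.im = 0)).prod := by
    refine Multiset.prod_nonneg fun z hz => ?_
    obtain ⟨hz, him⟩ := Multiset.mem_filter.1 hz
    lift z to ℝ using him
    exact_mod_cast hreal z hz
  rw [hsplit, Multiset.prod_add, Multiset.prod_add, hlower, ← map_multiset_prod]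
  exact mul_nonneg hreal_prod (mul_star_self_nonneg _)

theorem multiset_prod_map_max_one_norm (s : Multiset ℂ) :
    (s.map fun z => max 1 ‖z‖).prod = ‖(s.filter (1 < ‖·‖)).prod‖ := by
  induction s using Multiset.induction with
  | empty => simp
  | cons z s ih => by_cases hz : 1 < ‖z‖ <;> simp [hz, ih, le_of_lt, not_lt.1]

theorem mahlerMeasure_eq_norm_leadingCoeff_mul_norm_prodRootsOutside (p : ℂ[X]) :
    p.mahlerMeasure = ‖p.leadingCoeff‖ * ‖prodRootsOutside p‖ := by
  rw [mahlerMeasure_eq_leadingCoeff_mul_prod_roots, multiset_prod_map_max_one_norm,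
    prodRootsOutside]

theorem prodRootsOutside_nonneg {p : ℂ[X]} (hconj : p.map (starRingEnd ℂ) = p)
    (hroot : ∀ x : ℝ, x < -1 → ¬ p.IsRoot x) : 0 ≤ prodRootsOutside p := by
  have hroots : p.roots.map conj = p.roots := by
    rw [← (IsAlgClosed.splits p).roots_map (starRingEnd ℂ), hconj]
  refine multiset_prod_nonneg_of_map_conj_eq ?_ fun x hx => ?_
  · conv_rhs => rw [← hroots]
    simp [Multiset.filter_map]
  · obtain ⟨hx, hnorm⟩ := Multiset.mem_filter.1 hx
    have habs : 1 < |x| := by simpa using hnorm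
    by_contra! hneg
    exact hroot x (by linarith [abs_of_neg hneg]) (isRoot_of_mem_roots hx)

theorem prodRootsOutside_eq_mahlerMeasure {p : ℂ[X]} (hmonic : p.Monic)
    (hconj : p.map (starRingEnd ℂ) = p) (hroot : ∀ x : ℝ, x < -1 → ¬ p.IsRoot x) :
    prodRootsOutside p = (p.mahlerMeasure : ℂ) := by
  rw [mahlerMeasure_eq_norm_leadingCoeff_mul_norm_prodRootsOutside, hmonic.leadingCoeff, norm_one,
    one_mul]
  exact Complex.eq_coe_norm_of_nonneg (prodRootsOutside_nonneg hconj hroot)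

end RootProducts

section NonnegSeries

variable {α ι : Type*} [MeasurableSpace α] {μ : Measure α} {F : ι → α → ℝ} {f : α → ℝ}

theorem integrable_of_hasSum_of_nonneg (hF : ∀ i, AEStronglyMeasurable (F i) μ)
    (hnonneg : ∀ᵐ x ∂μ, ∀ i, 0 ≤ F i x) (hsum : ∀ᵐ x ∂μ, HasSum (fun i => F i x) (f x))
    (hf : Integrable f μ) (i : ι) : Integrable (F i) μ := by
  refine hf.mono' (hF i) ?_
  filter_upwards [hnonneg, hsum] with x hx hsumx
  rw [Real.norm_of_nonneg (hx i)]
  exact le_hasSum hsumx i fun j _ => hx j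

theorem summable_integral_of_hasSum_of_nonneg (hF : ∀ i, AEStronglyMeasurable (F i) μ)
    (hnonneg : ∀ᵐ x ∂μ, ∀ i, 0 ≤ F i x) (hsum : ∀ᵐ x ∂μ, HasSum (fun i => F i x) (f x))
    (hf : Integrable f μ) : Summable fun i => ∫ x, F i x ∂μ := by
  have hFint := integrable_of_hasSum_of_nonneg hF hnonneg hsum hf
  refine summable_of_sum_le (c := ∫ x, f x ∂μ)
    (fun i => integral_nonneg_of_ae (hnonneg.mono fun x hx => hx i)) fun u => ?_
  rw [← integral_finsetSum u fun i _ => hFint i]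
  refine integral_mono_ae (integrable_finsetSum u fun i _ => hFint i) hf ?_
  filter_upwards [hnonneg, hsum] with x hx hsumx
  exact sum_le_hasSum u (fun i _ => hx i) hsumx

end NonnegSeries

section Oscillation

variable {s : Set ℝ}

theorem tendsto_setIntegral_circleMap_pow_smul {E : Type*} [NormedAddCommGroup E]
    [NormedSpace ℂ E] (hs : MeasurableSet s) (f : ℝ → E) :
    Tendsto (fun n : ℕ => ∫ t in s, circleMap 0 1 t ^ n • f t) atTop (𝓝 0) := by
  have hfreq : Tendsto (fun n : ℕ => -((n : ℝ) * (2 * Real.pi)⁻¹)) atTop (cocompact ℝ) :=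
    (tendsto_neg_atTop_atBot.comp (tendsto_natCast_atTop_atTop.atTop_mul_const
      (by positivity))).mono_right atBot_le_cocompact
  refine ((Real.tendsto_integral_exp_smul_cocompact (s.indicator f)).comp hfreq).congr fun n => ?_
  rw [Function.comp_apply, ← integral_indicator hs]
  refine integral_congr_ae (.of_forall fun t => ?_)
  have hchar : (Real.fourierChar (-(t * -(n * (2 * Real.pi)⁻¹))) : ℂ) = circleMap 0 1 t ^ n := by
    rw [Real.fourierChar_apply, circleMap_zero, Complex.ofReal_one, one_mul, ← Complex.exp_nat_mul]
    push_cast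
    field_simp
  simp only [Circle.smul_def, hchar, Set.indicator_smul_apply]

theorem tendsto_setIntegral_tsum_mul_pow (hs : MeasurableSet s) (c : ℕ → ℂ) {g : ℝ → ℂ}
    {G : ℝ → ℝ} (hg : AEStronglyMeasurable g (volume.restrict s))
    (hsum : ∀ᵐ t ∂volume.restrict s, HasSum (fun k => ‖c k‖ * ‖g t‖ ^ (k + 1)) (G t))
    (hG : IntegrableOn G s) :
    Tendsto (fun n : ℕ => ∫ t in s, ∑' k, c k * (circleMap 0 1 t ^ n * g t) ^ (k + 1))
      atTop (𝓝 0) := by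
  let F (n k : ℕ) (t : ℝ) : ℂ := c k * (circleMap 0 1 t ^ n * g t) ^ (k + 1)
  have hFnorm (n k t) : ‖F n k t‖ = ‖c k‖ * ‖g t‖ ^ (k + 1) := by simp [F]
  have hFmeas (n k) : AEStronglyMeasurable (F n k) (volume.restrict s) := by
    have : Continuous fun t => circleMap 0 1 t ^ n := by fun_prop
    fun_prop
  have hmeas (k) : AEStronglyMeasurable (fun t => ‖c k‖ * ‖g t‖ ^ (k + 1))
      (volume.restrict s) := by fun_prop
  have hnonneg : ∀ᵐ t ∂volume.restrict s, ∀ k, 0 ≤ ‖c k‖ * ‖g t‖ ^ (k + 1) :=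
    .of_forall fun t k => by positivity
  have hsummable := summable_integral_of_hasSum_of_nonneg hmeas hnonneg hsum hG
  have hFint (n k) : IntegrableOn (F n k) s :=
    (integrable_of_hasSum_of_nonneg hmeas hnonneg hsum hG k).mono' (hFmeas n k)
      (.of_forall fun t => (hFnorm n k t).le)
  have hswap (n) : ∫ t in s, ∑' k, F n k t = ∑' k, ∫ t in s, F n k t :=
    (integral_tsum_of_summable_integral_norm (hFint n) (by simpa only [hFnorm])).symm
  have hterm (k) : Tendsto (fun n => ∫ t in s, F n k t) atTop (𝓝 0) := by
    refine ((tendsto_setIntegral_circleMap_pow_smul hs fun t => c k * g t ^ (k + 1)).comp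
      (tendsto_id.atTop_mul_const' k.succ_pos)).congr fun n => ?_
    refine integral_congr_ae (.of_forall fun t => ?_)
    simp only [F, id, smul_eq_mul, pow_mul, Nat.succ_eq_add_one]
    ring
  refine Tendsto.congr (fun n => (hswap n).symm) ?_
  simpa only [tsum_zero] using tendsto_tsum_of_dominated_convergence hsummable hterm
    (.of_forall fun n k =>
      (norm_integral_le_integral_norm _).trans_eq (by simp only [hFnorm]))

theorem norm_log_one_sub_le_neg_log_one_sub_norm {z : ℂ} (hz : ‖z‖ < 1) :
    ‖Complex.log (1 - z)‖ ≤ -Real.log (1 - ‖z‖) := by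
  rw [← norm_neg]
  refine (Complex.hasSum_taylorSeries_neg_log' hz).norm_le_of_bounded
    (Real.hasSum_pow_div_log_of_abs_lt_one (by rwa [abs_norm])) fun k => ?_
  rw [norm_div, norm_pow]
  norm_cast

variable {g : ℝ → ℂ}

theorem integrableOn_log_one_sub_circleMap_pow_mul
    (hg : AEStronglyMeasurable g (volume.restrict s))
    (hlt : ∀ᵐ t ∂volume.restrict s, ‖g t‖ < 1)
    (hint : IntegrableOn (fun t => Real.log (1 - ‖g t‖)) s) (n : ℕ) :
    IntegrableOn (fun t => Complex.log (1 - circleMap 0 1 t ^ n * g t)) s := by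
  refine hint.neg.mono' ?_ ?_
  · exact (Complex.measurable_log.comp_aemeasurable (by fun_prop)).aestronglyMeasurable
  · filter_upwards [hlt] with t ht
    simpa using norm_log_one_sub_le_neg_log_one_sub_norm
      (z := circleMap 0 1 t ^ n * g t) (by simpa using ht)

theorem tendsto_setIntegral_log_one_sub_circleMap_pow_mul (hs : MeasurableSet s)
    (hg : AEStronglyMeasurable g (volume.restrict s))
    (hlt : ∀ᵐ t ∂volume.restrict s, ‖g t‖ < 1)
    (hint : IntegrableOn (fun t => Real.log (1 - ‖g t‖)) s) :
    Tendsto (fun n : ℕ => ∫ t in s, Complex.log (1 - circleMap 0 1 t ^ n * g t)) atTop (𝓝 0) := by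
  have hmajorant : ∀ᵐ t ∂volume.restrict s,
      HasSum (fun k : ℕ => ‖-(k + 1 : ℂ)⁻¹‖ * ‖g t‖ ^ (k + 1)) (-Real.log (1 - ‖g t‖)) := by
    filter_upwards [hlt] with t ht
    convert! Real.hasSum_pow_div_log_of_abs_lt_one (x := ‖g t‖) (by rwa [abs_norm]) using 2 with k
    rw [norm_neg, norm_inv, div_eq_inv_mul]
    norm_cast
  refine (tendsto_setIntegral_tsum_mul_pow hs (fun k => -(k + 1 : ℂ)⁻¹) hg hmajorant
    hint.neg).congr fun n => integral_congr_ae ?_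
  filter_upwards [hlt] with t ht
  have hseries := Complex.hasSum_taylorSeries_neg_log'
    (z := circleMap 0 1 t ^ n * g t) (by simpa using ht)
  rw [← neg_neg (Complex.log _), ← hseries.neg.tsum_eq]
  exact tsum_congr fun k => by ring

theorem integrableOn_log_norm_one_sub_circleMap_pow_mul
    (hg : AEStronglyMeasurable g (volume.restrict s))
    (hlt : ∀ᵐ t ∂volume.restrict s, ‖g t‖ < 1)
    (hint : IntegrableOn (fun t => Real.log (1 - ‖g t‖)) s) (n : ℕ) :
    IntegrableOn (fun t => Real.log ‖1 - circleMap 0 1 t ^ n * g t‖) s := by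
  simpa only [IntegrableOn, Complex.log_re, RCLike.re_eq_complex_re]
    using (integrableOn_log_one_sub_circleMap_pow_mul hg hlt hint n).re

theorem tendsto_setIntegral_log_norm_one_sub_circleMap_pow_mul (hs : MeasurableSet s)
    (hg : AEStronglyMeasurable g (volume.restrict s))
    (hlt : ∀ᵐ t ∂volume.restrict s, ‖g t‖ < 1)
    (hint : IntegrableOn (fun t => Real.log (1 - ‖g t‖)) s) :
    Tendsto (fun n : ℕ => ∫ t in s, Real.log ‖1 - circleMap 0 1 t ^ n * g t‖) atTop (𝓝 0) := by
  refine ((Complex.continuous_re.tendsto 0).comp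
    (tendsto_setIntegral_log_one_sub_circleMap_pow_mul hs hg hlt hint)).congr fun n => ?_
  have hre := integral_re (integrableOn_log_one_sub_circleMap_pow_mul hg hlt hint n)
  simpa only [Function.comp_apply, RCLike.re_eq_complex_re, Complex.log_re] using hre.symm

end Oscillation

section FoldToDisc

/-- The point of the closed unit disc obtained from `z` by complex conjugation if `‖z‖ ≤ 1` and by
complex inversion otherwise. It turns the distance from `z` to a point `w` of the unit circle into
`max 1 ‖z‖ * ‖1 - w * foldToDisc z‖`. -/
noncomputable def foldToDisc (z : ℂ) : ℂ :=
  if 1 < ‖z‖ then z⁻¹ else conj z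

theorem measurable_foldToDisc : Measurable foldToDisc :=
  Measurable.ite (measurableSet_lt measurable_const measurable_norm) measurable_inv
    Complex.continuous_conj.measurable

theorem one_sub_norm_foldToDisc (z : ℂ) :
    1 - ‖foldToDisc z‖ = |1 - ‖z‖| / max 1 ‖z‖ := by
  unfold foldToDisc
  split_ifs with hz
  · rw [norm_inv, max_eq_right hz.le, abs_of_neg (by linarith)]
    field_simp
    ring
  · rw [Complex.norm_conj, max_eq_left (not_lt.1 hz), div_one, abs_of_nonneg (by linarith)]

theorem norm_foldToDisc_lt_one {z : ℂ} (hz : ‖z‖ ≠ 1) : ‖foldToDisc z‖ < 1 := by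
  have : 0 < |1 - ‖z‖| := abs_pos.2 (sub_ne_zero.2 hz.symm)
  rw [← sub_pos, one_sub_norm_foldToDisc]
  positivity

theorem log_one_sub_norm_foldToDisc {z : ℂ} (hz : ‖z‖ ≠ 1) :
    Real.log (1 - ‖foldToDisc z‖) = Real.log (1 - ‖z‖) - Real.posLog ‖z‖ := by
  have : |1 - ‖z‖| ≠ 0 := abs_ne_zero.2 (sub_ne_zero.2 hz.symm)
  rw [one_sub_norm_foldToDisc, Real.log_div this (by positivity), Real.log_abs,
    Real.posLog_eq_log_max_one (norm_nonneg z)]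

theorem norm_sub_eq_max_mul_norm_one_sub_mul_foldToDisc {w : ℂ} (hw : ‖w‖ = 1) (z : ℂ) :
    ‖w - z‖ = max 1 ‖z‖ * ‖1 - w * foldToDisc z‖ := by
  unfold foldToDisc
  split_ifs with hz
  · have hz0 : z ≠ 0 := norm_pos_iff.1 (zero_lt_one.trans hz)
    rw [max_eq_right hz.le, ← norm_mul, norm_sub_rev]
    congr 1
    field_simp
  · have hww : w * conj w = 1 := by simp [Complex.mul_conj', hw]
    calc ‖w - z‖ = ‖w * conj (w - z)‖ := by rw [norm_mul, hw, one_mul, Complex.norm_conj]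
      _ = max 1 ‖z‖ * ‖1 - w * conj z‖ := by
        rw [max_eq_left (not_lt.1 hz), one_mul, map_sub, mul_sub, hww]

theorem log_norm_sub_eq_posLog_add_log {w z : ℂ} (hw : ‖w‖ = 1) (hz : ‖z‖ ≠ 1) :
    Real.log ‖w - z‖ = Real.posLog ‖z‖ + Real.log ‖1 - w * foldToDisc z‖ := by
  have hne : ‖1 - w * foldToDisc z‖ ≠ 0 := fun h => (norm_foldToDisc_lt_one hz).ne <| by
    simpa [hw] using (congrArg norm (sub_eq_zero.1 (norm_eq_zero.1 h))).symm
  rw [norm_sub_eq_max_mul_norm_one_sub_mul_foldToDisc hw, Real.log_mul (by positivity) hne,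
    Real.posLog_eq_log_max_one (norm_nonneg z)]

-- `Real.log (1 - ‖h t‖)` is `log |1 - ‖h t‖|`, so `hlog` also constrains `h` where `‖h t‖ > 1`.
theorem tendsto_setIntegral_log_norm_circleMap_pow_sub {s : Set ℝ} (hs : MeasurableSet s)
    {h : ℝ → ℂ} (hh : AEStronglyMeasurable h (volume.restrict s))
    (hne : ∀ᵐ t ∂volume.restrict s, ‖h t‖ ≠ 1)
    (hlog : IntegrableOn (fun t => Real.log (1 - ‖h t‖)) s)
    (hposLog : IntegrableOn (fun t => Real.posLog ‖h t‖) s) :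
    Tendsto (fun n : ℕ => ∫ t in s, Real.log ‖circleMap 0 1 t ^ n - h t‖) atTop
      (𝓝 (∫ t in s, Real.posLog ‖h t‖)) := by
  have hmeas : AEStronglyMeasurable (fun t => foldToDisc (h t)) (volume.restrict s) :=
    (measurable_foldToDisc.comp_aemeasurable hh.aemeasurable).aestronglyMeasurable
  have hlt : ∀ᵐ t ∂volume.restrict s, ‖foldToDisc (h t)‖ < 1 :=
    hne.mono fun t => norm_foldToDisc_lt_one
  have hint : IntegrableOn (fun t => Real.log (1 - ‖foldToDisc (h t)‖)) s :=
    (hlog.sub hposLog).congr (hne.mono fun t ht => (log_one_sub_norm_foldToDisc ht).symm)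
  have hlim := (tendsto_setIntegral_log_norm_one_sub_circleMap_pow_mul hs hmeas hlt hint).const_add
    (∫ t in s, Real.posLog ‖h t‖)
  rw [add_zero] at hlim
  refine hlim.congr fun n => ?_
  rw [← integral_add hposLog
    (integrableOn_log_norm_one_sub_circleMap_pow_mul hmeas hlt hint n)]
  refine integral_congr_ae (hne.mono fun t ht => ?_)
  exact (log_norm_sub_eq_posLog_add_log (by simp) ht).symm

end FoldToDisc

section MahlerLimit

variable {q : ℂ[X]}

theorem analyticAt_one_sub_norm_sq_eval_circleMap (q : ℂ[X]) (t : ℝ) :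
    AnalyticAt ℝ (fun t => 1 - ‖q.eval (circleMap 0 1 t)‖ ^ 2) t := by
  have heval : AnalyticAt ℝ (fun t => q.eval (circleMap 0 1 t)) t := by
    simpa only [coe_aeval_eq_eval] using
      (analyticOnNhd_circleMap 0 1 t (Set.mem_univ t)).aeval_polynomial q
  have hre := (Complex.reCLM.analyticAt _).comp heval
  have him := (Complex.imCLM.analyticAt _).comp heval
  simp_rw [Complex.sq_norm, Complex.normSq_apply]
  exact analyticAt_const.sub ((hre.mul hre).add (him.mul him))

theorem ae_norm_eval_circleMap_ne_one {z : ℂ} (hz : ‖z‖ = 1) (hqz : ‖q.eval z‖ ≠ 1) :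
    ∀ᵐ t : ℝ, ‖q.eval (circleMap 0 1 t)‖ ≠ 1 := by
  obtain ⟨t₀, ht₀⟩ : z ∈ Set.range (circleMap 0 1) := by simpa using hz
  have hcodiscrete := AnalyticOnNhd.preimage_zero_mem_codiscrete (x := t₀)
    (fun t _ => analyticAt_one_sub_norm_sq_eval_circleMap q t)
    (by rw [ht₀]; contrapose! hqz; nlinarith [norm_nonneg (q.eval z)])
  have hae := ae_restrict_le_codiscreteWithin (μ := volume) .univ hcodiscrete
  rw [Measure.restrict_univ] at hae
  filter_upwards [hae] with t ht hnorm
  exact ht (by simp [hnorm])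

theorem intervalIntegrable_log_one_sub_norm_eval_circleMap
    (hne : ∀ᵐ t : ℝ, ‖q.eval (circleMap 0 1 t)‖ ≠ 1) (u v : ℝ) :
    IntervalIntegrable (fun t => Real.log (1 - ‖q.eval (circleMap 0 1 t)‖)) volume u v := by
  have hsq : IntervalIntegrable (fun t => Real.log (1 - ‖q.eval (circleMap 0 1 t)‖ ^ 2))
      volume u v :=
    MeromorphicOn.intervalIntegrable_log fun t _ =>
      (analyticAt_one_sub_norm_sq_eval_circleMap q t).meromorphicAt
  have hadd : IntervalIntegrable (fun t => Real.log (1 + ‖q.eval (circleMap 0 1 t)‖))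
      volume u v :=
    Continuous.intervalIntegrable (.log (by fun_prop) fun t => by positivity) u v
  refine (hsq.sub hadd).congr_ae (ae_restrict_of_ae ?_)
  filter_upwards [hne] with t ht
  have hfactor : 1 - ‖q.eval (circleMap 0 1 t)‖ ^ 2 =
      (1 - ‖q.eval (circleMap 0 1 t)‖) * (1 + ‖q.eval (circleMap 0 1 t)‖) := by ring
  rw [hfactor, Real.log_mul (sub_ne_zero.2 ht.symm) (by positivity), add_sub_cancel_right]

theorem tendsto_logMahlerMeasure_X_pow_sub {z : ℂ} (hz : ‖z‖ = 1) (hqz : ‖q.eval z‖ ≠ 1) :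
    Tendsto (fun n : ℕ => (X ^ n - q).logMahlerMeasure) atTop
      (𝓝 (Real.circleAverage (fun w => Real.posLog ‖q.eval w‖) 0 1)) := by
  have hne := ae_norm_eval_circleMap_ne_one hz hqz
  have hcont : Continuous fun t => q.eval (circleMap 0 1 t) := by fun_prop
  have hposLog : IntervalIntegrable (fun t => Real.posLog ‖q.eval (circleMap 0 1 t)‖)
      volume 0 (2 * Real.pi) :=
    Continuous.intervalIntegrable (by fun_prop) _ _
  have hlim := tendsto_setIntegral_log_norm_circleMap_pow_sub measurableSet_Ioc
    hcont.aestronglyMeasurable (ae_restrict_of_ae hne)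
    (intervalIntegrable_log_one_sub_norm_eval_circleMap hne 0 (2 * Real.pi)).1 hposLog.1
  simp_rw [logMahlerMeasure_def, Real.circleAverage_def,
    intervalIntegral.integral_of_le Real.two_pi_pos.le, eval_sub, eval_pow, eval_X]
  exact hlim.const_smul _

theorem tendsto_mahlerMeasure_X_pow_sub {z : ℂ} (hz : ‖z‖ = 1) (hqz : ‖q.eval z‖ ≠ 1) :
    Tendsto (fun n : ℕ => (X ^ n - q).mahlerMeasure) atTop
      (𝓝 (Real.exp (Real.circleAverage (fun w => Real.posLog ‖q.eval w‖) 0 1))) := by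
  refine ((Real.continuous_exp.tendsto _).comp
    (tendsto_logMahlerMeasure_X_pow_sub hz hqz)).congr' ?_
  filter_upwards [eventually_gt_atTop q.natDegree] with n hn
  have hmonic : (X ^ n - q).Monic :=
    monic_X_pow_sub (degree_le_natDegree.trans_lt (by exact_mod_cast hn))
  rw [Function.comp_apply, logMahlerMeasure_eq_log_MahlerMeasure,
    Real.exp_log (mahlerMeasure_pos_of_ne_zero hmonic.ne_zero)]

end MahlerLimit

section CircleAverage

theorem intervalIntegral_period_of_even {E : Type*} [NormedAddCommGroup E] [NormedSpace ℝ E]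
    {f : ℝ → E} {T : ℝ} (heven : Function.Even f) (hper : Function.Periodic f (2 * T))
    (hf : IntervalIntegrable f volume 0 T) :
    ∫ t in (0 : ℝ)..2 * T, f t = (2 : ℝ) • ∫ t in (0 : ℝ)..T, f t := by
  have hshift := hper.intervalIntegral_add_eq 0 (-T)
  rw [zero_add, (by ring : -T + 2 * T = T)] at hshift
  have hreflect : ∫ t in -T..0, f t = ∫ t in (0 : ℝ)..T, f t := by
    simpa [heven _] using (intervalIntegral.integral_comp_neg (a := 0) (b := T) f).symm
  have hf' : IntervalIntegrable f volume (-T) 0 := by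
    simpa [heven _] using (IntervalIntegrable.iff_comp_neg (f := f) |>.1 hf).symm
  rw [hshift, ← intervalIntegral.integral_add_adjacent_intervals hf' hf, hreflect, two_smul]

theorem norm_mul_circleMap_add_one_sq (a t : ℝ) :
    ‖a * circleMap 0 1 t + 1‖ ^ 2 = 1 + a ^ 2 + 2 * a * Real.cos t := by
  rw [Complex.sq_norm, Complex.normSq_apply]
  simp only [circleMap_zero, Complex.ofReal_one, one_mul, Complex.add_re, Complex.mul_re,
    Complex.ofReal_re, Complex.exp_ofReal_mul_I_re, Complex.ofReal_im, Complex.exp_ofReal_mul_I_im,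
    zero_mul, sub_zero, Complex.one_re, Complex.add_im, Complex.mul_im, add_zero, Complex.one_im]
  linear_combination a ^ 2 * Real.sin_sq_add_cos_sq t

theorem posLog_norm_mul_circleMap_add_one (a t : ℝ) :
    Real.posLog ‖a * circleMap 0 1 t + 1‖ =
      2⁻¹ * Real.posLog (1 + a ^ 2 + 2 * a * Real.cos t) := by
  rw [← norm_mul_circleMap_add_one_sq, Real.posLog_pow]
  ring

theorem circleAverage_posLog_norm_mul_add_one (a : ℝ) :
    Real.circleAverage (fun z => Real.posLog ‖a * z + 1‖) 0 1 =
      (1 / (2 * Real.pi)) *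
        ∫ t in (0 : ℝ)..Real.pi, Real.posLog (1 + a ^ 2 + 2 * a * Real.cos t) := by
  have hfold := intervalIntegral_period_of_even (T := Real.pi)
    (f := fun t => Real.posLog (1 + a ^ 2 + 2 * a * Real.cos t)) (fun t => by simp)
    (fun t => by simp) (Continuous.intervalIntegrable (by fun_prop) _ _)
  simp_rw [Real.circleAverage_def, posLog_norm_mul_circleMap_add_one,
    intervalIntegral.integral_const_mul, hfold, smul_eq_mul]
  ring

theorem le_cos_of_le_arccos {x t : ℝ} (hx : x ≤ 1) (ht : 0 ≤ t)
    (hle : t ≤ Real.arccos x) : x ≤ Real.cos t := by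
  by_cases hx' : -1 ≤ x
  · exact (Real.cos_arccos hx' hx).symm.trans_le
      (Real.cos_le_cos_of_nonneg_of_le_pi ht (Real.arccos_le_pi _) hle)
  · linarith [Real.neg_one_le_cos t]

theorem cos_lt_of_arccos_lt {x t : ℝ} (ht : t ≤ Real.pi)
    (hlt : Real.arccos x < t) : Real.cos t < x := by
  by_contra! hle
  have := Real.arccos_le_arccos hle
  rw [Real.arccos_cos ((Real.arccos_nonneg x).trans hlt.le) ht] at this
  exact this.not_gt hlt

theorem integral_posLog_one_add_sq_add_two_mul_cos {a : ℝ} (ha : 0 ≤ a) :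
    ∫ t in (0 : ℝ)..Real.pi, Real.posLog (1 + a ^ 2 + 2 * a * Real.cos t) =
      ∫ t in (0 : ℝ)..Real.arccos (-a / 2), Real.log (1 + a ^ 2 + 2 * a * Real.cos t) := by
  have hnonneg (t : ℝ) : 0 ≤ 1 + a ^ 2 + 2 * a * Real.cos t := by
    rw [← norm_mul_circleMap_add_one_sq]
    positivity
  have hint (u v : ℝ) : IntervalIntegrable
      (fun t => Real.posLog (1 + a ^ 2 + 2 * a * Real.cos t)) volume u v :=
    Continuous.intervalIntegrable (by fun_prop) u v
  have houter : ∫ t in Real.arccos (-a / 2)..Real.pi,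
      Real.posLog (1 + a ^ 2 + 2 * a * Real.cos t) = 0 := by
    rw [intervalIntegral.integral_congr_Ioo_of_le (g := fun _ => 0) (Real.arccos_le_pi _),
      intervalIntegral.integral_zero]
    intro t ht
    have hcos := cos_lt_of_arccos_lt ht.2.le ht.1
    rw [Real.posLog_eq_zero_iff, abs_of_nonneg (hnonneg t)]
    nlinarith
  rw [← intervalIntegral.integral_add_adjacent_intervals (hint 0 (Real.arccos (-a / 2)))
    (hint _ _), houter, add_zero]
  refine intervalIntegral.integral_congr fun t ht => Real.posLog_eq_log ?_
  rw [Set.uIcc_of_le (Real.arccos_nonneg _)] at ht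
  have hcos := le_cos_of_le_arccos (by linarith) ht.1 ht.2
  rw [abs_of_nonneg (hnonneg t)]
  nlinarith

end CircleAverage

section Trinomial

theorem unitTrinomial_eq_X_pow_sub (a : ℝ) (n : ℕ) :
    unitTrinomial a n = X ^ n - (C (a : ℂ) * X + 1) :=
  sub_sub _ _ _

theorem unitTrinomial_monic (a : ℝ) {n : ℕ} (hn : 2 ≤ n) : (unitTrinomial a n).Monic := by
  rw [unitTrinomial_eq_X_pow_sub]
  refine monic_X_pow_sub (degree_linear_le.trans_lt ?_)
  exact_mod_cast hn

theorem unitTrinomial_map_conj (a : ℝ) (n : ℕ) :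
    (unitTrinomial a n).map (starRingEnd ℂ) = unitTrinomial a n := by
  simp [unitTrinomial]

theorem not_isRoot_unitTrinomial_of_lt_neg_one {a : ℝ} (ha : a ∈ Set.Icc (0 : ℝ) 2) {n : ℕ}
    (hn : 2 ≤ n) {x : ℝ} (hx : x < -1) : ¬ (unitTrinomial a n).IsRoot x := by
  intro hroot
  have hpow : x ^ n = a * x + 1 := by
    have h : (x : ℂ) ^ n - a * x - 1 = 0 := by simpa [unitTrinomial] using hroot
    have h' : x ^ n - a * x - 1 = 0 := by exact_mod_cast h
    linarith
  have hlinear : |a * x + 1| < |x| ^ 2 := by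
    rw [sq_abs, abs_lt]
    constructor <;> nlinarith [ha.1, ha.2]
  have hmono : |x| ^ 2 ≤ |x| ^ n := pow_le_pow_right₀ (by linarith [neg_le_abs x]) hn
  rw [← hpow, abs_pow] at hlinear
  exact hlinear.not_ge hmono

theorem prodRootsOutside_unitTrinomial {a : ℝ} (ha : a ∈ Set.Icc (0 : ℝ) 2) {n : ℕ} (hn : 2 ≤ n) :
    prodRootsOutside (unitTrinomial a n) = ((unitTrinomial a n).mahlerMeasure : ℂ) :=
  prodRootsOutside_eq_mahlerMeasure (unitTrinomial_monic a hn) (unitTrinomial_map_conj a n)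
    fun _ hx => not_isRoot_unitTrinomial_of_lt_neg_one ha hn hx

theorem tendsto_mahlerMeasure_unitTrinomial {a : ℝ} (ha : 0 < a) :
    Tendsto (fun n : ℕ => (unitTrinomial a n).mahlerMeasure) atTop
      (𝓝 (Real.exp ((1 / (2 * Real.pi)) * ∫ t in (0 : ℝ)..Real.arccos (-a / 2),
        Real.log (1 + a ^ 2 + 2 * a * Real.cos t)))) := by
  have hone : ‖(C (a : ℂ) * X + 1).eval 1‖ ≠ 1 := by
    have : ‖(C (a : ℂ) * X + 1).eval 1‖ = a + 1 := by
      simpa using Complex.norm_of_nonneg (r := a + 1) (by positivity)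
    linarith
  have hlim := tendsto_mahlerMeasure_X_pow_sub norm_one hone
  simp only [eval_add, eval_mul, eval_C, eval_X, eval_one, ← unitTrinomial_eq_X_pow_sub] at hlim
  rwa [circleAverage_posLog_norm_mul_add_one, integral_posLog_one_add_sq_add_two_mul_cos ha.le]
    at hlim

end Trinomial

theorem theorem1p2 (a : ℝ) (ha : a ∈ Set.Ioc (0 : ℝ) 2) :
    (∀ n : ℕ, 2 ≤ n →
      prodRootsOutside (unitTrinomial a n) = ((unitTrinomial a n).mahlerMeasure : ℂ)) ∧
    Filter.Tendsto (fun n : ℕ => prodRootsOutside (unitTrinomial a n)) Filter.atTop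
      (nhds ((Real.exp ((1 / (2 * Real.pi)) *
        ∫ t in (0 : ℝ)..Real.arccos (-a / 2),
          Real.log (1 + a ^ 2 + 2 * a * Real.cos t)) : ℝ) : ℂ)) := by
  have hprod (n : ℕ) (hn : 2 ≤ n) :
      prodRootsOutside (unitTrinomial a n) = ((unitTrinomial a n).mahlerMeasure : ℂ) :=
    prodRootsOutside_unitTrinomial (Set.Ioc_subset_Icc_self ha) hn
  refine ⟨hprod, ((Complex.continuous_ofReal.tendsto _).comp
    (tendsto_mahlerMeasure_unitTrinomial ha.1)).congr' ?_⟩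
  filter_upwards [eventually_ge_atTop 2] with n hn using (hprod n hn).symm
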